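/- A p-algebra is a bounded distributive lattice with a unary operation $*$ such that $x\le y^*$ iff $x\wedge y=0$. A quasivariety of p-algebras is a class of p-algebras axiomatized by quasi-identities; $\mathbf Q(\mathbf A)$ denotes the quasivariety generated by $\mathbf A$, and $\mathsf{Pa}_m=\mathbf{HSP}(\bar{\mathbf B}_m)$, where $\bar{\mathbf B}_m$ is the Boolean algebra with $m$ atoms with a new top element added. A quasivariety $\mathsf K$ is a cover of $\mathsf{Pa}_m$ if $\mathsf{Pa}_m\subsetneq\mathsf K$ and no quasivariety of p-algebras lies strictly between them. For a poset $P$, $\varepsilon(P)$ is the p-algebra of all upsets of $P$ ordered by inclusion. For $x\in P$ let $M(x)$ be the set of maximal elements of $P$ above $x$; a map $h:P\to Q$ of posets is a pp-morphism if it is order-preserving and $M(h(x))=h[M(x)]$ for all $x\in P$. For a set $M$ and a family $\mathcal F$ of non-empty subsets of $M$, $P(M,\mathcal F)$ is the set $\{M\}\cup\{\{x\}:x\in M\}\cup\mathcal F$ ordered by reverse inclusion. **Theorem.** Let $m\ge 2$, let $|M|=m+1$, let $a,b\in M$ be distinct, and put $\mathcal E=\{\{a,b\},\,M\setminus\{a\},\,M\setminus\{b\}\}$.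 1. If $\mathcal F\subsetneq\mathcal E$, then $\mathbf Q(\varepsilon(P(M,\mathcal F)))$ is not a cover of $\mathsf{Pa}_m$. 2. For all $\mathcal F,\mathcal G\subseteq\mathcal E$, there is a surjective pp-morphism from a disjoint union of finitely many copies of $P(M,\mathcal F)$ onto $P(M,\mathcal G)$ if and only if there is a permutation $\sigma$ of $\mathcal E$ with $|\sigma(X)|=|X|$ for all $X\in\mathcal E$ and $\sigma[\mathcal F]\subseteq\mathcal G$. -/

import Mathlib

universe u v

/-! ### p-algebras -/

/-- A p-algebra: a bounded distributive lattice with a pseudocomplement `x ↦ x*`,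
i.e. `x ≤ y*` iff `x ⊓ y = ⊥`. -/
class PAlgebra (A : Type u) extends DistribLattice A, BoundedOrder A where
  star : A → A
  le_star_iff : ∀ x y : A, x ≤ star y ↔ x ⊓ y = ⊥

/-- Homomorphisms of p-algebras. -/
structure IsPAlgebraHom {A : Type u} {B : Type v} [PAlgebra A] [PAlgebra B] (f : A → B) :
    Prop where
  map_bot : f ⊥ = ⊥
  map_top : f ⊤ = ⊤
  map_inf : ∀ x y, f (x ⊓ y) = f x ⊓ f y
  map_sup : ∀ x y, f (x ⊔ y) = f x ⊔ f y
  map_star : ∀ x, f (PAlgebra.star x) = PAlgebra.star (f x)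

/-- Direct powers (with componentwise operations). -/
instance PAlgebra.power (I : Type u) (B : Type v) [PAlgebra B] : PAlgebra (I → B) where
  star x := fun i => PAlgebra.star (x i)
  le_star_iff x y := by
    simp only [Pi.le_def, PAlgebra.le_star_iff, funext_iff, Pi.inf_apply, Pi.bot_apply]

/-- A bundled p-algebra; classes of p-algebras are sets of these. -/
structure PAlg where
  carrier : Type u
  [str : PAlgebra carrier]

attribute [instance] PAlg.str

/-! ### Quasi-identities and quasivarieties -/

/-- Terms in the language of p-algebras over the variables `x₀, x₁, x₂, …`. -/
inductive PTerm where
  | var : ℕ → PTerm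
  | bot : PTerm
  | top : PTerm
  | inf : PTerm → PTerm → PTerm
  | sup : PTerm → PTerm → PTerm
  | star : PTerm → PTerm

/-- The value of a term under an assignment of the variables. -/
def PTerm.eval {A : Type u} [PAlgebra A] (v : ℕ → A) : PTerm → A
  | .var n => v n
  | .bot => ⊥
  | .top => ⊤
  | .inf s t => s.eval v ⊓ t.eval v
  | .sup s t => s.eval v ⊔ t.eval v
  | .star t => PAlgebra.star (t.eval v)

/-- A quasi-identity `s₁ = t₁ ∧ ⋯ ∧ sₙ = tₙ → s = t` (with `n ≥ 0`). -/
structure QuasiIdentity where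
  premises : List (PTerm × PTerm)
  lhs : PTerm
  rhs : PTerm

/-- Validity of a quasi-identity in a p-algebra (universally quantified over assignments). -/
def QuasiIdentity.HoldsIn (q : QuasiIdentity) (A : Type u) [PAlgebra A] : Prop :=
  ∀ v : ℕ → A, (∀ e ∈ q.premises, e.1.eval v = e.2.eval v) → q.lhs.eval v = q.rhs.eval v

/-- A quasivariety of p-algebras: the class of all p-algebras satisfying some set of
quasi-identities. -/
def IsQuasivariety (K : Set PAlg.{u}) : Prop :=
  ∃ S : Set QuasiIdentity, K = {A | ∀ q ∈ S, q.HoldsIn A.carrier}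

/-- `Q(A)`, the quasivariety generated by the p-algebra `A`: the class of all p-algebras that
satisfy every quasi-identity valid in `A`. -/
def quasivarietyOf (A : PAlg.{u}) : Set PAlg.{u} :=
  {B | ∀ q : QuasiIdentity, q.HoldsIn A.carrier → q.HoldsIn B.carrier}

/-- `K` covers `V` in the lattice of quasivarieties of p-algebras (for quasivarieties `V`, `K`):
`V` is properly contained in `K` and there is no quasivariety strictly between them. -/
def IsQuasivarietyCover (V K : Set PAlg.{u}) : Prop :=
  V ⊂ K ∧ ∀ L : Set PAlg.{u}, IsQuasivariety L → V ⊆ L → L ⊆ K → L = V ∨ L = K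

/-! ### The varieties `Pa_m` -/

/-- `B̄_k`: the Boolean algebra with `k` atoms, with a new top element added above its top. -/
def BBar (k : ℕ) : Type := WithTop (Set (Fin k))

open Classical in
/-- The pseudocomplement of `B̄_k`: the new top goes to `⊥`, the bottom to the new top, and any
other element to its Boolean complement. -/
noncomputable def BBar.starAux (k : ℕ) : WithTop (Set (Fin k)) → WithTop (Set (Fin k))
  | none => ⊥
  | some x => if x = ∅ then ⊤ else ((xᶜ : Set (Fin k)) : WithTop (Set (Fin k)))

noncomputable instance (k : ℕ) : PAlgebra (BBar k) where
  toDistribLattice := inferInstanceAs (DistribLattice (WithTop (Set (Fin k))))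
  toBoundedOrder := inferInstanceAs (BoundedOrder (WithTop (Set (Fin k))))
  star := BBar.starAux k
  le_star_iff x y := by
    have key : ∀ x y : WithTop (Set (Fin k)), x ≤ BBar.starAux k y ↔ x ⊓ y = ⊥ := by
      intro x y
      have hbot : (⊥ : WithTop (Set (Fin k))) = ((∅ : Set (Fin k)) : WithTop (Set (Fin k))) := rfl
      induction y using WithTop.recTopCoe with
      | top =>
        change x ≤ ⊥ ↔ _
        simp
      | coe y =>
        change x ≤ (if y = ∅ then ⊤ else ((yᶜ : Set (Fin k)) : WithTop (Set (Fin k)))) ↔ _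
        by_cases hy : y = ∅
        · subst hy
          rw [← hbot]
          simp
        · rw [if_neg hy]
          induction x using WithTop.recTopCoe with
          | top => simp [hbot, hy]
          | coe x =>
            rw [← WithTop.coe_inf, hbot, WithTop.coe_le_coe, WithTop.coe_inj]
            exact Set.subset_compl_iff_disjoint_right.trans Set.disjoint_iff_inter_eq_empty
    exact key x y

/-- The class `HSP(B)` of all homomorphic images of algebras embeddable into a power of `B`. -/
def HSP (B : Type) [PAlgebra B] : Set PAlg.{u} :=
  {A | ∃ (I : Type u) (C : PAlg.{u}) (i : C.carrier → (I → B)) (f : C.carrier → A.carrier),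
    IsPAlgebraHom i ∧ Function.Injective i ∧ IsPAlgebraHom f ∧ Function.Surjective f}

/-- The variety `Pa_m = HSP(B̄_m)`. -/
def Pa (m : ℕ) : Set PAlg.{u} := HSP (BBar m)

/-! ### Posets and their dual p-algebras -/

/-- The upsets of a poset, ordered by inclusion. -/
def Upset (P : Type u) [PartialOrder P] : Type u := {U : Set P // IsUpperSet U}

/-- The p-algebra of upsets: meet and join are intersection and union, and `U*` is the largest
upset disjoint from `U`. -/
instance (P : Type u) [PartialOrder P] : PAlgebra (Upset P) where
  le U V := U.1 ⊆ V.1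
  le_refl _ := subset_rfl
  le_trans _ _ _ := Set.Subset.trans
  le_antisymm _ _ h h' := Subtype.ext (Set.Subset.antisymm h h')
  inf U V := ⟨U.1 ∩ V.1, U.2.inter V.2⟩
  sup U V := ⟨U.1 ∪ V.1, U.2.union V.2⟩
  inf_le_left _ _ := Set.inter_subset_left
  inf_le_right _ _ := Set.inter_subset_right
  le_inf _ _ _ := Set.subset_inter
  le_sup_left _ _ := Set.subset_union_left
  le_sup_right _ _ := Set.subset_union_right
  sup_le _ _ _ := Set.union_subset
  le_sup_inf U V W := (Set.union_inter_distrib_left U.1 V.1 W.1).ge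
  bot := ⟨∅, isUpperSet_empty⟩
  top := ⟨Set.univ, isUpperSet_univ⟩
  bot_le U := Set.empty_subset U.1
  le_top U := Set.subset_univ U.1
  star U := ⟨{x | ∀ y, x ≤ y → y ∉ U.1}, fun _ _ hxy hx z hz => hx z (hxy.trans hz)⟩
  le_star_iff U V := by
    constructor
    · intro h
      exact Subtype.ext (Set.eq_empty_of_forall_notMem fun x hx => h hx.1 x le_rfl hx.2)
    · intro h x hx y hxy hy
      have : y ∈ (∅ : Set P) := (congrArg Subtype.val h).subset ⟨U.2 hxy hx, hy⟩
      exact this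

/-- `ε(P)`, the p-algebra dual to the poset `P`. -/
def dualAlg (P : Type u) [PartialOrder P] : PAlg.{u} := ⟨Upset P⟩

/-- `M(x)`: the set of maximal elements above `x`. -/
def maxAbove {P : Type u} [PartialOrder P] (x : P) : Set P := {y | x ≤ y ∧ IsMax y}

/-- pp-morphisms: order-preserving maps `h` with `M(h(x)) = h[M(x)]` for all `x`. -/
structure IsPPMorphism {P : Type u} {Q : Type v} [PartialOrder P] [PartialOrder Q] (h : P → Q) :
    Prop where
  monotone : Monotone h
  map_maxAbove : ∀ x, maxAbove (h x) = h '' maxAbove x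

/-- The reduced poset `P(M, F)`: its elements are the set `M`, the singletons `{m}` with `m ∈ M`,
and the members of the family `F`. -/
def ReducedPoset {M : Type u} (F : Set (Set M)) : Type u :=
  {A : Set M // A = Set.univ ∨ (∃ m, A = {m}) ∨ A ∈ F}

/-- `P(M, F)` is ordered by reverse inclusion. -/
instance {M : Type u} (F : Set (Set M)) : PartialOrder (ReducedPoset F) where
  le A B := B.1 ⊆ A.1
  le_refl _ := subset_rfl
  le_trans _ _ _ h h' := Set.Subset.trans h' h
  le_antisymm _ _ h h' := Subtype.ext (Set.Subset.antisymm h' h)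

/-- The family `{{a, b}, M - {a}, M - {b}}`. -/
def specialFamily {M : Type u} (a b : M) : Set (Set M) := {{a, b}, {a}ᶜ, {b}ᶜ}

/-! Reduced posets are rigid: a pp-morphism P(M,F) → P(M,G) is induced by a self-map f of M, each
element going to its image (`ReducedPoset.exists_image_eq_of_isPPMorphism`). If the element M is
hit, f is a permutation, so members of F, having between 2 and m elements, go to members of G.
Conversely, a size-preserving σ comes from a permutation τ of M (`exists_perm_image_eq`). Morphisms
induced by τ and by maps collapsing M onto a member of G reach every point
(`exists_ppMorphism_covering`); the last kind exist because of the shape of the special family E.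

For non-covers, let L be generated by Pa_m and ε(P(M,E)). Covering P(M,E) by images of P(M,F) puts L
inside Q(ε(P(M,F))). In Pa_m the pseudocomplements of m+1 pairwise disjoint elements join to ⊤
(`sup_star_eq_top_of_mem_Pa`), which fails for the atoms of ε(P(M,E)), so L ≠ Pa_m. The upper
inclusion is strict by the quasi-identity saying that every homomorphism from ε(P(M,F)) sends the
corresponding join to ⊤. It fails in ε(P(M,F)) itself and holds in Pa_m. A counterexample in
ε(P(M,E)) would give a permutation of M whose preimage map injects E into the smaller F
(`ReducedPoset.exists_preimage_of_hom`). -/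

open Set

/-! ### Homomorphisms and quasi-identities -/

section Hom

variable {A : Type*} {B : Type*} [PAlgebra A] [PAlgebra B]

/-- A p-algebra homomorphism as a homomorphism of bounded lattices. -/
def IsPAlgebraHom.toBoundedLatticeHom {f : A → B} (hf : IsPAlgebraHom f) :
    BoundedLatticeHom A B where
  toFun := f
  map_sup' := hf.map_sup
  map_inf' := hf.map_inf
  map_top' := hf.map_top
  map_bot' := hf.map_bot

theorem IsPAlgebraHom.map_finset_sup {f : A → B} (hf : IsPAlgebraHom f) {ι : Type*}
    (s : Finset ι) (g : ι → A) : f (s.sup g) = s.sup fun i => f (g i) :=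
  _root_.map_finset_sup hf.toBoundedLatticeHom s g

theorem IsPAlgebraHom.map_finset_inf {f : A → B} (hf : IsPAlgebraHom f) {ι : Type*}
    (s : Finset ι) (g : ι → A) : f (s.inf g) = s.inf fun i => f (g i) :=
  _root_.map_finset_inf hf.toBoundedLatticeHom s g

theorem IsPAlgebraHom.eval {f : A → B} (hf : IsPAlgebraHom f) (v : ℕ → A) (t : PTerm) :
    t.eval (fun n => f (v n)) = f (t.eval v) := by
  induction t with
  | var n => rfl
  | bot => exact hf.map_bot.symm
  | top => exact hf.map_top.symm
  | inf s t hs ht => simp only [PTerm.eval, hs, ht, hf.map_inf]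
  | sup s t hs ht => simp only [PTerm.eval, hs, ht, hf.map_sup]
  | star t ht => simp only [PTerm.eval, ht, hf.map_star]

theorem isPAlgebraHom_id : IsPAlgebraHom (id : A → A) :=
  ⟨rfl, rfl, fun _ _ => rfl, fun _ _ => rfl, fun _ => rfl⟩

/-- Quasi-identities are inherited along a separating family of homomorphisms. -/
theorem QuasiIdentity.HoldsIn.of_separating {q : QuasiIdentity} (hq : q.HoldsIn B)
    (hsep : ∀ x y : A, (∀ f : A → B, IsPAlgebraHom f → f x = f y) → x = y) :
    q.HoldsIn A := by
  intro v hv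
  refine hsep _ _ fun f hf => ?_
  rw [← hf.eval, ← hf.eval]
  refine hq _ fun e he => ?_
  rw [hf.eval, hf.eval, hv e he]

end Hom

theorem PAlgebra.star_bot {A : Type*} [PAlgebra A] : PAlgebra.star (⊥ : A) = ⊤ :=
  top_le_iff.1 ((PAlgebra.le_star_iff _ _).2 (inf_bot_eq _))

theorem PAlgebra.inf_star_self {A : Type*} [PAlgebra A] (x : A) : x ⊓ PAlgebra.star x = ⊥ := by
  rw [inf_comm]
  exact (PAlgebra.le_star_iff _ _).1 le_rfl

/-- The quasi-identity saying that every homomorphism from a given finite p-algebra identifies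
two given elements. -/
theorem exists_quasiIdentity_iff_hom {A : Type u} [PAlgebra A] [Finite A] (x y : A) :
    ∃ q : QuasiIdentity, ∀ (B : Type u) [PAlgebra B],
      q.HoldsIn B ↔ ∀ f : A → B, IsPAlgebraHom f → f x = f y := by
  classical
  have := Fintype.ofFinite A
  obtain ⟨n, ⟨e⟩⟩ := Finite.exists_equiv_fin A
  let code : A → ℕ := fun z => e z
  -- The default ⊥ is immaterial: only variables of the form `code z` occur below.
  let dec : ℕ → A := fun k => if h : k < n then e.symm ⟨k, h⟩ else ⊥
  have dec_code : ∀ z, dec (code z) = z := fun z => by simp [dec, code]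
  let V : A → PTerm := fun z => .var (code z)
  let l : List A := Finset.univ.toList
  have hl : ∀ z, z ∈ l := fun z => by simp [l]
  -- The premises are the operation tables of `A`, so the assignments satisfying them are exactly
  -- the homomorphisms out of `A`.
  let prem : List (PTerm × PTerm) :=
    (V ⊥, .bot) :: (V ⊤, .top) ::
      (l.map (fun z => (V (PAlgebra.star z), .star (V z))) ++
        (l.product l).map (fun p => (V (p.1 ⊓ p.2), .inf (V p.1) (V p.2))) ++
        (l.product l).map (fun p => (V (p.1 ⊔ p.2), .sup (V p.1) (V p.2))))
  refine ⟨⟨prem, V x, V y⟩, fun B _ => ⟨fun h f hf => ?_, fun h v hv => ?_⟩⟩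
  · have := h (fun k => f (dec k)) (fun p hp => ?_)
    · simpa [V, PTerm.eval, dec_code] using this
    · simp only [prem, List.mem_cons, List.mem_append, List.mem_map] at hp
      rcases hp with rfl | rfl | (⟨z, -, rfl⟩ | ⟨z, -, rfl⟩) | ⟨z, -, rfl⟩ <;>
        simp only [V, PTerm.eval, dec_code, hf.map_bot, hf.map_top, hf.map_inf, hf.map_sup,
          hf.map_star]
  · refine h (fun z => v (code z)) ⟨?_, ?_, fun z w => ?_, fun z w => ?_, fun z => ?_⟩
    · exact hv (V ⊥, .bot) (by simp [prem])
    · exact hv (V ⊤, .top) (by simp [prem])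
    · refine hv (V (z ⊓ w), .inf (V z) (V w)) ?_
      simp only [prem, List.mem_cons, List.mem_append, List.mem_map]
      exact .inr <| .inr <| .inl <| .inr ⟨(z, w), List.mem_product.2 ⟨hl z, hl w⟩, rfl⟩
    · refine hv (V (z ⊔ w), .sup (V z) (V w)) ?_
      simp only [prem, List.mem_cons, List.mem_append, List.mem_map]
      exact .inr <| .inr <| .inr ⟨(z, w), List.mem_product.2 ⟨hl z, hl w⟩, rfl⟩
    · refine hv (V (PAlgebra.star z), .star (V z)) ?_
      simp only [prem, List.mem_cons, List.mem_append, List.mem_map]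
      exact .inr <| .inr <| .inl <| .inl ⟨z, hl z, rfl⟩

/-! ### Disjoint elements in `Pa_m` -/

/-- Pigeonhole on the m atoms: every nonzero element lies above one, including the new top because m
> 0. -/
theorem BBar.exists_eq_bot {ι : Type*} [Finite ι] {m : ℕ} (hm : 0 < m) (hι : m < Nat.card ι)
    (x : ι → BBar m) (hx : ∀ i j, i ≠ j → x i ⊓ x j = ⊥) : ∃ i, x i = ⊥ := by
  classical
  have := Fintype.ofFinite ι
  by_contra! hne
  have key : ∀ z : WithTop (Set (Fin m)), z ≠ ⊥ →
      ∃ p : Fin m, (({p} : Set (Fin m)) : WithTop (Set (Fin m))) ≤ z := by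
    intro z hz
    induction z using WithTop.recTopCoe with
    | top => exact ⟨⟨0, hm⟩, le_top⟩
    | coe s =>
      obtain ⟨p, hp⟩ : s.Nonempty := by
        rw [nonempty_iff_ne_empty]
        rintro rfl
        exact hz rfl
      exact ⟨p, WithTop.coe_le_coe.2 (singleton_subset_iff.2 hp)⟩
  choose p hp using fun i => key (x i) (hne i)
  obtain ⟨i, j, hij, hpij⟩ := Fintype.exists_ne_map_eq_of_card_lt p
    (by rwa [Fintype.card_fin, ← Nat.card_eq_fintype_card])
  have hle : (({p i} : Set (Fin m)) : WithTop (Set (Fin m))) ≤ ⊥ := by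
    have h2 := hp j
    rw [← hpij] at h2
    exact (le_inf (hp i) h2).trans (hx i j hij).le
  have : ({p i} : Set (Fin m)) ≤ ∅ := WithTop.coe_le_coe.1 hle
  exact this rfl

/-- In each coordinate of a power of `BBar m` some element is ⊥, with pseudocomplement ⊤. Quotients
need more care, as disjointness must first be lifted. -/
theorem sup_star_eq_top_of_mem_Pa {m : ℕ} (hm : 0 < m) {A : PAlg.{u}} (hA : A ∈ Pa m)
    {ι : Type*} [Fintype ι] (hι : m < Nat.card ι) (x : ι → A.carrier)
    (hx : ∀ i j, i ≠ j → x i ⊓ x j = ⊥) :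
    Finset.univ.sup (fun i => PAlgebra.star (x i)) = ⊤ := by
  classical
  obtain ⟨I, C, g, f, hg, hginj, hf, hfsurj⟩ := hA
  choose c hc using fun i => hfsurj (x i)
  -- Meeting each lift with the pseudocomplements of the others forces disjointness without changing
  -- the image under `f`.
  let y : ι → C.carrier := fun i =>
    c i ⊓ (Finset.univ.erase i).inf fun j => PAlgebra.star (c j)
  have hy : ∀ i j, i ≠ j → y i ⊓ y j = ⊥ := by
    intro i j hij
    have h1 : y i ≤ PAlgebra.star (c j) :=
      inf_le_right.trans (Finset.inf_le (by simp [hij.symm]))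
    have h2 : y j ≤ c j := inf_le_left
    rw [← le_bot_iff, ← PAlgebra.inf_star_self (c j), inf_comm]
    exact inf_le_inf h2 h1
  have hfy : ∀ i, f (y i) = x i := by
    intro i
    simp only [y, hf.map_inf, hf.map_finset_inf, hf.map_star, hc]
    refine inf_eq_left.2 (Finset.le_inf fun j hj => ?_)
    exact (PAlgebra.le_star_iff _ _).2 (hx i j (Finset.ne_of_mem_erase hj).symm)
  have htop : Finset.univ.sup (fun i => PAlgebra.star (y i)) = ⊤ := by
    apply hginj
    rw [hg.map_top, hg.map_finset_sup]
    funext k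
    obtain ⟨i, hi⟩ := BBar.exists_eq_bot hm hι (fun i => g (y i) k) (fun i j hij => by
      have := congrFun (hg.map_inf (y i) (y j)) k
      rw [hy i j hij, hg.map_bot] at this
      exact this.symm)
    have hle := Finset.le_sup (f := fun i => g (PAlgebra.star (y i))) (Finset.mem_univ i) k
    have hstar : g (PAlgebra.star (y i)) k = ⊤ := by
      rw [hg.map_star]
      change PAlgebra.star (g (y i) k) = ⊤
      rw [hi, PAlgebra.star_bot]
    exact top_le_iff.1 (hstar.symm.le.trans hle)
  have := congrArg f htop
  simpa only [hf.map_finset_sup, hf.map_star, hfy, hf.map_top] using this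

/-! ### Upset algebras -/

section Upset

variable {P : Type*} {Q : Type*} [PartialOrder P] [PartialOrder Q]

theorem Upset.mem_star {U : Upset P} {x : P} :
    x ∈ (PAlgebra.star U).1 ↔ ∀ y, x ≤ y → y ∉ U.1 := Iff.rfl

theorem Upset.mem_finset_sup {ι : Type*} {s : Finset ι} {U : ι → Upset P} {x : P} :
    x ∈ (s.sup U).1 ↔ ∃ i ∈ s, x ∈ (U i).1 := by
  classical
  induction s using Finset.induction_on with
  | empty => exact ⟨fun h => absurd h (notMem_empty x), by simp⟩
  | insert i s his ih =>
    rw [Finset.sup_insert]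
    change x ∈ (U i).1 ∪ (s.sup U).1 ↔ _
    simp [ih]

instance [Finite P] : Finite (Upset P) := inferInstanceAs (Finite {U : Set P // IsUpperSet U})

theorem exists_isMax_ge [Finite P] (x : P) : ∃ y, x ≤ y ∧ IsMax y := by
  obtain ⟨y, hxy, hy⟩ := (Set.toFinite {y : P | x ≤ y}).exists_le_maximal
    (show x ∈ {y : P | x ≤ y} from le_rfl)
  exact ⟨y, hxy, fun z hz => hy.2 (hxy.trans hz) hz⟩

/-- The preimage of an upset under a monotone map. -/
def Upset.preimage {h : P → Q} (hh : Monotone h) (U : Upset Q) : Upset P :=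
  ⟨h ⁻¹' U.1, U.2.preimage hh⟩

/-- The p-algebra homomorphism dual to a pp-morphism. -/
theorem IsPPMorphism.isPAlgebraHom_preimage [Finite P] [Finite Q] {h : P → Q}
    (hh : IsPPMorphism h) :
    IsPAlgebraHom (Upset.preimage hh.monotone) where
  map_bot := rfl
  map_top := rfl
  map_inf _ _ := rfl
  map_sup _ _ := rfl
  map_star U := by
    apply Subtype.ext
    ext x
    refine ⟨fun hx y hxy => hx _ (hh.monotone hxy), fun hx y hxy hyU => ?_⟩
    -- The pp-condition lifts only maximal elements, so the witness is first pushed up to one.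
    obtain ⟨z, hyz, hz⟩ := exists_isMax_ge y
    have hmem : z ∈ maxAbove (h x) := ⟨hxy.trans hyz, hz⟩
    rw [hh.map_maxAbove] at hmem
    obtain ⟨w, ⟨hxw, -⟩, rfl⟩ := hmem
    exact hx w hxw (U.2 hyz hyU)

/-- Two upsets that differ at h x have preimages under h that differ at x, so the dual homomorphisms
separate points. -/
theorem QuasiIdentity.HoldsIn.upset_of_covering [Finite P] [Finite Q]
    (hcov : ∀ y : Q, ∃ (h : P → Q) (x : P), IsPPMorphism h ∧ h x = y)
    {q : QuasiIdentity} (hq : q.HoldsIn (Upset P)) : q.HoldsIn (Upset Q) := by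
  refine hq.of_separating fun U V hUV => Subtype.ext ?_
  ext y
  obtain ⟨h, x, hh, rfl⟩ := hcov y
  have := congrArg Subtype.val (hUV (Upset.preimage hh.monotone) hh.isPAlgebraHom_preimage)
  exact Set.ext_iff.1 this x

/-- For a homomorphism between algebras of upsets of finite posets, the prime filter of upsets
whose image contains a given point is principal. -/
theorem IsPAlgebraHom.exists_dual_point [Finite P] {g : Upset P → Upset Q}
    (hg : IsPAlgebraHom g) (y : Q) : ∃ p : P, ∀ U, y ∈ (g U).1 ↔ p ∈ U.1 := by
  classical
  have := Fintype.ofFinite P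
  have hgmono : ∀ U V : Upset P, U ≤ V → (g U).1 ⊆ (g V).1 := fun U V hUV =>
    OrderHomClass.mono hg.toBoundedLatticeHom hUV
  let up : P → Upset P := fun p => ⟨Ici p, isUpperSet_Ici p⟩
  -- Primeness: an upset is a finite join of principal ones, one of which must already be in the
  -- filter.
  have hcover : ∀ U : Upset P, y ∈ (g U).1 → ∃ p ∈ U.1, y ∈ (g (up p)).1 := by
    intro U hU
    have hUeq : U = (Finset.univ.filter (· ∈ U.1)).sup up := by
      apply Subtype.ext
      ext p
      rw [Upset.mem_finset_sup]
      exact ⟨fun hp => ⟨p, by simpa using hp, le_refl p⟩,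
        fun ⟨i, hi, hip⟩ => U.2 hip (by simpa using hi)⟩
    rw [hUeq, hg.map_finset_sup, Upset.mem_finset_sup] at hU
    obtain ⟨p, hp, hyp⟩ := hU
    exact ⟨p, by simpa using hp, hyp⟩
  obtain ⟨p₀, -, hp₀⟩ := hcover ⊤ (by rw [hg.map_top]; trivial)
  obtain ⟨p, -, hp⟩ := (Set.toFinite {p : P | y ∈ (g (up p)).1}).exists_le_maximal hp₀
  refine ⟨p, fun U => ⟨fun hU => ?_, fun hU => ?_⟩⟩
  · have hmem : y ∈ (g (up p ⊓ U)).1 := by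
      rw [hg.map_inf]
      exact ⟨hp.1, hU⟩
    obtain ⟨p', ⟨hpp', hp'U⟩, hyp'⟩ := hcover _ hmem
    exact (le_antisymm hpp' (hp.2 hyp' hpp')) ▸ hp'U
  · exact hgmono (up p) U (fun z hz => U.2 hz hU) hp.1

end Upset

/-! ### Reduced posets -/

namespace ReducedPoset

variable {M : Type u} {F G : Set (Set M)}

instance [Finite M] : Finite (ReducedPoset F) :=
  inferInstanceAs (Finite {A : Set M // A = Set.univ ∨ (∃ m, A = {m}) ∨ A ∈ F})

/-- The maximal element given by a singleton. -/
def point (x : M) : ReducedPoset F := ⟨{x}, .inr (.inl ⟨x, rfl⟩)⟩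

theorem point_injective : Function.Injective (point : M → ReducedPoset F) := fun _ _ h =>
  singleton_injective (congrArg Subtype.val h)

theorem le_point_iff {p : ReducedPoset F} {x : M} : p ≤ point x ↔ x ∈ p.1 :=
  singleton_subset_iff

theorem nonempty [Nonempty M] (hF : ∀ X ∈ F, X.Nonempty) (p : ReducedPoset F) :
    p.1.Nonempty := by
  rcases p.2 with h | ⟨x, h⟩ | h
  · rw [h]; exact univ_nonempty
  · rw [h]; exact singleton_nonempty x
  · exact hF _ h

theorem isMax_iff [Nonempty M] (hF : ∀ X ∈ F, X.Nonempty) {p : ReducedPoset F} :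
    IsMax p ↔ ∃ x, p = point x := by
  constructor
  · intro hp
    obtain ⟨x, hx⟩ := nonempty hF p
    exact ⟨x, hp.eq_of_le (le_point_iff.2 hx)⟩
  · rintro ⟨x, rfl⟩ q hq
    obtain ⟨y, hy⟩ := nonempty hF q
    have : y = x := hq hy
    exact singleton_subset_iff.2 (this ▸ hy)

theorem maxAbove_eq [Nonempty M] (hF : ∀ X ∈ F, X.Nonempty) (p : ReducedPoset F) :
    maxAbove p = point '' p.1 := by
  ext q
  simp only [maxAbove, mem_ofPred_eq, isMax_iff hF, mem_image]
  constructor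
  · rintro ⟨hpq, x, rfl⟩
    exact ⟨x, le_point_iff.1 hpq, rfl⟩
  · rintro ⟨x, hx, rfl⟩
    exact ⟨le_point_iff.2 hx, x, rfl⟩

/-- The map of reduced posets induced by a map of the underlying sets. -/
def map (f : M → M) (huniv : range f = univ ∨ (∃ x, range f = {x}) ∨ range f ∈ G)
    (hf : ∀ X ∈ F, f '' X = univ ∨ (∃ x, f '' X = {x}) ∨ f '' X ∈ G)
    (p : ReducedPoset F) : ReducedPoset G :=
  ⟨f '' p.1, by
    rcases p.2 with h | ⟨x, h⟩ | h
    · rwa [h, image_univ]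
    · rw [h, image_singleton]; exact .inr (.inl ⟨_, rfl⟩)
    · exact hf _ h⟩

theorem isPPMorphism_map [Nonempty M] (hF : ∀ X ∈ F, X.Nonempty) (hG : ∀ X ∈ G, X.Nonempty)
    (f : M → M) (huniv : range f = univ ∨ (∃ x, range f = {x}) ∨ range f ∈ G)
    (hf : ∀ X ∈ F, f '' X = univ ∨ (∃ x, f '' X = {x}) ∨ f '' X ∈ G) :
    IsPPMorphism (map f huniv hf) where
  monotone _ _ h := image_mono h
  map_maxAbove p := by
    rw [maxAbove_eq hF, maxAbove_eq hG]
    change point '' (f '' p.1) = _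
    rw [image_image, image_image]
    exact image_congr fun x _ => Subtype.ext (image_singleton).symm

/-- Every pp-morphism of reduced posets is induced by a map of the underlying sets. -/
theorem exists_image_eq_of_isPPMorphism [Nonempty M] (hF : ∀ X ∈ F, X.Nonempty)
    (hG : ∀ X ∈ G, X.Nonempty) {h : ReducedPoset F → ReducedPoset G} (hh : IsPPMorphism h) :
    ∃ f : M → M, ∀ p, (h p).1 = f '' p.1 := by
  have hmax : ∀ x, ∃ y, h (point x) = point y := by
    intro x
    rw [← isMax_iff hG]
    have : h (point x) ∈ maxAbove (h (point x)) := by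
      rw [hh.map_maxAbove]
      exact ⟨point x, ⟨le_rfl, (isMax_iff hF).2 ⟨x, rfl⟩⟩, rfl⟩
    exact this.2
  choose f hf using hmax
  refine ⟨f, fun p => ?_⟩
  have := hh.map_maxAbove p
  rw [maxAbove_eq hF, maxAbove_eq hG, image_image] at this
  simp only [hf] at this
  rw [← image_image point f] at this
  exact point_injective.image_injective this

/-- The atom of the algebra of upsets corresponding to a maximal element. -/
def atom [Nonempty M] (hF : ∀ X ∈ F, X.Nonempty) (x : M) : Upset (ReducedPoset F) :=
  ⟨{point x}, fun _ _ hpq hp => by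
    rw [mem_singleton_iff] at hp ⊢
    subst hp
    exact (((isMax_iff hF).2 ⟨x, rfl⟩).eq_of_le hpq).symm⟩

theorem atom_inf_atom [Nonempty M] (hF : ∀ X ∈ F, X.Nonempty) {x y : M} (hxy : x ≠ y) :
    atom hF x ⊓ atom hF y = ⊥ := by
  apply Subtype.ext
  change {point x} ∩ {point y} = (∅ : Set (ReducedPoset F))
  simpa [eq_empty_iff_forall_notMem] using fun h => hxy (point_injective h)

theorem mem_star_atom [Nonempty M] (hF : ∀ X ∈ F, X.Nonempty) {x : M} {p : ReducedPoset F} :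
    p ∈ (PAlgebra.star (atom hF x)).1 ↔ x ∉ p.1 := by
  rw [Upset.mem_star, ← le_point_iff]
  exact ⟨fun h hp => h _ hp rfl, fun h y hpy hy => h (hy ▸ hpy)⟩

/-- The least element M lies below every maximal element, hence in none of these pseudocomplements.
-/
theorem sup_star_atom_ne_top [Nonempty M] [Fintype M] (hF : ∀ X ∈ F, X.Nonempty) :
    Finset.univ.sup (fun x => PAlgebra.star (atom hF x)) ≠ ⊤ := by
  intro h
  let p : ReducedPoset F := ⟨univ, .inl rfl⟩
  have hmem : p ∈ (Finset.univ.sup (fun x => PAlgebra.star (atom hF x))).1 := by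
    rw [h]; trivial
  obtain ⟨x, -, hx⟩ := Upset.mem_finset_sup.1 hmem
  exact (mem_star_atom hF).1 hx (mem_univ x)

/-- A homomorphism that does not collapse the join of the pseudocomplements of the atoms to the
top element comes from a permutation of the underlying set. -/
theorem exists_preimage_of_hom [Nonempty M] [Fintype M] (hF : ∀ X ∈ F, X.Nonempty)
    (hG : ∀ X ∈ G, X.Nonempty) {g : Upset (ReducedPoset F) → Upset (ReducedPoset G)}
    (hg : IsPAlgebraHom g)
    (hne : g (Finset.univ.sup (fun x => PAlgebra.star (atom hF x))) ≠ g ⊤) :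
    ∃ s : M → M, Function.Bijective s ∧
      ∀ q : ReducedPoset G, ∃ p : ReducedPoset F, p.1 = s ⁻¹' q.1 := by
  have hpoint : ∀ (U : Upset (ReducedPoset G)) q, q ∉ (PAlgebra.star U).1 ↔
      ∃ x ∈ q.1, point x ∈ U.1 := by
    intro U q
    rw [Upset.mem_star]
    push Not
    constructor
    · rintro ⟨r, hqr, hr⟩
      obtain ⟨x, hx⟩ := nonempty hG r
      exact ⟨x, hqr hx, U.2 (le_point_iff.2 hx) hr⟩
    · rintro ⟨x, hx, hU⟩
      exact ⟨_, le_point_iff.2 hx, hU⟩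
  obtain ⟨y, hy⟩ : ∃ y, ∀ x, y ∉ (PAlgebra.star (g (atom hF x))).1 := by
    by_contra! hcon
    apply hne
    rw [hg.map_top, hg.map_finset_sup]
    apply Subtype.ext
    refine eq_univ_of_forall fun y => ?_
    rw [Upset.mem_finset_sup]
    obtain ⟨x, hx⟩ := hcon y
    exact ⟨x, Finset.mem_univ x, by rwa [hg.map_star]⟩
  -- A maximal element above `y` is chosen inside the image of each atom; distinct atoms have
  -- disjoint images, so `s` is injective.
  choose s _ hs using fun x => (hpoint _ _).1 (hy x)
  have hdisj : ∀ x x' z, point z ∈ (g (atom hF x)).1 → point z ∈ (g (atom hF x')).1 →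
      x = x' := by
    intro x x' z h h'
    by_contra hxx
    have hmem : point z ∈ (g (atom hF x ⊓ atom hF x')).1 := by
      rw [hg.map_inf]
      exact ⟨h, h'⟩
    rw [atom_inf_atom hF hxx, hg.map_bot] at hmem
    exact hmem
  have hinj : Function.Injective s := fun x x' h => hdisj x x' (s x) (hs x) (h ▸ hs x')
  have hbij : Function.Bijective s := Finite.injective_iff_bijective.1 hinj
  refine ⟨s, hbij, fun q => ?_⟩
  -- Testing the dual point `p` of `q` on the pseudocomplements of atoms shows which elements of M
  -- it contains.
  obtain ⟨p, hp⟩ := hg.exists_dual_point q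
  refine ⟨p, ?_⟩
  ext x
  rw [← not_iff_not, ← mem_star_atom hF, ← hp, hg.map_star, ← not_iff_not, not_not, hpoint,
    mem_preimage]
  constructor
  · rintro ⟨z, hz, hzx⟩
    obtain ⟨x', rfl⟩ := hbij.2 z
    rwa [hdisj x x' _ hzx (hs x')]
  · exact fun h => ⟨s x, h, hs x⟩

end ReducedPoset

/-! ### Disjoint unions of copies of a poset -/

section Copies

variable {P : Type*} {Q : Type*} [PartialOrder P] [PartialOrder Q] {ι : Type*}

theorem maxAbove_sigma_mk (i : ι) (x : P) :
    maxAbove (⟨i, x⟩ : Σ _ : ι, P) = (fun y => (⟨i, y⟩ : Σ _ : ι, P)) '' maxAbove x := by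
  have hmax : ∀ y : P, IsMax (⟨i, y⟩ : Σ _ : ι, P) ↔ IsMax y := by
    refine fun y => ⟨fun h z hz => ?_, fun h => ?_⟩
    · have hle : (⟨i, z⟩ : Σ _ : ι, P) ≤ ⟨i, y⟩ := h (Sigma.LE.fiber _ _ _ hz)
      obtain ⟨_, _, _, hle⟩ := hle
      exact hle
    · rintro ⟨j, z⟩ hz
      obtain ⟨_, _, _, hz⟩ := hz
      exact Sigma.LE.fiber _ _ _ (h hz)
  ext ⟨j, y⟩
  constructor
  · rintro ⟨hxy, hy⟩
    obtain ⟨_, _, _, hxy⟩ := hxy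
    exact ⟨y, ⟨hxy, (hmax y).1 hy⟩, rfl⟩
  · rintro ⟨z, ⟨hxz, hz⟩, h⟩
    rw [← h]
    exact ⟨Sigma.LE.fiber _ _ _ hxz, (hmax z).2 hz⟩

theorem isPPMorphism_sigma_iff {h : (Σ _ : ι, P) → Q} :
    IsPPMorphism h ↔ ∀ i, IsPPMorphism fun x => h ⟨i, x⟩ := by
  constructor
  · refine fun hh i => ⟨fun x y hxy => hh.monotone (Sigma.LE.fiber _ _ _ hxy), fun x => ?_⟩
    rw [hh.map_maxAbove, maxAbove_sigma_mk, image_image]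
  · refine fun hh => ⟨?_, fun ⟨i, x⟩ => ?_⟩
    · rintro ⟨i, x⟩ ⟨j, y⟩ hxy
      obtain ⟨_, _, _, hxy⟩ := hxy
      exact (hh i).monotone hxy
    · rw [(hh i).map_maxAbove x, maxAbove_sigma_mk, image_image]

theorem exists_copies_surjective_of_covering [Finite Q]
    (hcov : ∀ y : Q, ∃ (h : P → Q) (x : P), IsPPMorphism h ∧ h x = y) :
    ∃ (n : ℕ) (h : (Σ _ : Fin n, P) → Q), IsPPMorphism h ∧ Function.Surjective h := by
  obtain ⟨n, ⟨e⟩⟩ := Finite.exists_equiv_fin Q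
  choose h x hh hx using hcov
  refine ⟨n, fun z => h (e.symm z.1) z.2, isPPMorphism_sigma_iff.2 fun i => hh (e.symm i),
    fun y => ?_⟩
  exact ⟨⟨e y, x y⟩, by simp [hx]⟩

end Copies

/-! ### The special family -/

section Special

variable {M : Type u} {a b : M} {F G : Set (Set M)}

theorem specialFamily_comm (a b : M) : specialFamily a b = specialFamily b a := by
  unfold specialFamily
  rw [pair_comm a b, pair_comm ({a}ᶜ : Set M) {b}ᶜ]

theorem ncard_of_mem_specialFamily {m : ℕ} (hM : Nat.card M = m + 1) (hab : a ≠ b) {X : Set M}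
    (hX : X ∈ specialFamily a b) : X = {a, b} ∧ X.ncard = 2 ∨ X.ncard = m := by
  have := Nat.finite_of_card_ne_zero (hM.trans_ne m.succ_ne_zero)
  have hc : ∀ x : M, ({x}ᶜ : Set M).ncard = m := fun x => by
    have := ncard_add_ncard_compl {x}
    rw [ncard_singleton, hM] at this
    lia
  rcases hX with rfl | rfl | rfl
  · exact .inl ⟨rfl, ncard_pair hab⟩
  · exact .inr (hc a)
  · exact .inr (hc b)

/-- A member of a reduced poset that is neither a singleton nor the whole set lies in the family. -/
theorem ReducedPoset.mem_of_ncard {M : Type u} {F : Set (Set M)} (p : ReducedPoset F)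
    (h1 : p.1.ncard ≠ 1) (h2 : p.1 ≠ univ) : p.1 ∈ F := by
  rcases p.2 with h | ⟨x, h⟩ | h
  · exact absurd h h2
  · exact absurd (h ▸ ncard_singleton x) h1
  · exact h

theorem exists_ppMorphism_covering [Finite M] (hab : a ≠ b)
    (hF : ∀ X ∈ F, X.Nonempty) (hGE : G ⊆ specialFamily a b)
    (hG : ∀ X ∈ G, X.Nonempty) (τ : Equiv.Perm M) (hτ : ∀ X ∈ F, τ '' X ∈ G)
    (q : ReducedPoset G) :
    ∃ (h : ReducedPoset F → ReducedPoset G) (p : ReducedPoset F), IsPPMorphism h ∧ h p = q := by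
  classical
  have : Nonempty M := ⟨a⟩
  have of_range : ∀ f : M → M, range f ∈ G →
      (∀ X ∈ F, f '' X = univ ∨ (∃ x, f '' X = {x}) ∨ f '' X ∈ G) → range f = q.1 →
      ∃ (h : ReducedPoset F → ReducedPoset G) (p : ReducedPoset F),
        IsPPMorphism h ∧ h p = q := fun f h1 h2 h3 =>
    ⟨_, ⟨univ, .inl rfl⟩, ReducedPoset.isPPMorphism_map hF hG f (.inr (.inr h1)) h2,
      Subtype.ext (image_univ.trans h3)⟩
  have retract : ∀ a b : M, a ≠ b → G ⊆ specialFamily a b → q.1 = {a}ᶜ → {a}ᶜ ∈ G →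
      ∃ (h : ReducedPoset F → ReducedPoset G) (p : ReducedPoset F),
        IsPPMorphism h ∧ h p = q := by
    intro a b hab hGE hq hmem
    -- Collapsing a to b sends {a,b} to a singleton and both {a}ᶜ and {b}ᶜ to {a}ᶜ, so every member
    -- of the special family has an admissible image.
    let r : M → M := fun x => if x = a then b else x
    have hr : ∀ s : Set M, r '' s ⊆ {a}ᶜ := by
      rintro s _ ⟨x, -, rfl⟩
      by_cases hx : x = a
      · simp [r, hx, hab.symm]
      · simp [r, hx]
    have hra : r a = b := if_pos rfl
    have hrx : ∀ x, x ≠ a → r x = x := fun x hx => if_neg hx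
    have hcompl : r '' {a}ᶜ = {a}ᶜ := (hr _).antisymm fun x hx => ⟨x, hx, hrx x hx⟩
    have hrange : range (r ∘ τ) = {a}ᶜ := by
      rw [range_comp, τ.range_eq_univ]
      exact (hr _).antisymm (hcompl.symm.subset.trans (image_mono (subset_univ _)))
    refine of_range (r ∘ τ) (hrange ▸ hmem) (fun X hX => ?_) (hrange.trans hq.symm)
    rw [image_comp]
    rcases hGE (hτ X hX) with h | h | h <;> rw [h]
    · exact .inr (.inl ⟨b, by rw [image_pair, hra, hrx b hab.symm, pair_eq_singleton]⟩)
    · rw [hcompl]; exact .inr (.inr hmem)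
    · refine .inr (.inr ?_)
      convert hmem
      refine (hr _).antisymm fun x hx => ?_
      by_cases hxb : x = b
      · exact ⟨a, hab, hra.trans hxb.symm⟩
      · exact ⟨x, hxb, hrx x hx⟩
  have perm : ∀ p : ReducedPoset F, τ '' p.1 = q.1 →
      ∃ (h : ReducedPoset F → ReducedPoset G) (p : ReducedPoset F),
        IsPPMorphism h ∧ h p = q := fun p hp =>
    ⟨_, p, ReducedPoset.isPPMorphism_map hF hG τ (.inl τ.range_eq_univ)
      (fun X hX => .inr (.inr (hτ X hX))), Subtype.ext hp⟩
  rcases q.2 with h | ⟨x, h⟩ | h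
  · exact perm ⟨univ, .inl rfl⟩ (by rw [h, image_univ, τ.range_eq_univ])
  · exact perm (ReducedPoset.point (τ.symm x)) (by simp [ReducedPoset.point, h])
  · rcases hGE h with h' | h' | h'
    · let f : M → M := fun x => if x = a then a else b
      have hfs : ∀ s : Set M, f '' s ⊆ {a, b} := by
        rintro s _ ⟨x, -, rfl⟩
        by_cases hx : x = a <;> simp [f, hx]
      have hrange : range f = {a, b} := by
        refine (image_univ ▸ hfs univ).antisymm ?_
        rintro x (rfl | rfl)
        · exact ⟨x, if_pos rfl⟩
        · exact ⟨x, if_neg hab.symm⟩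
      refine of_range f (hrange ▸ h' ▸ h) (fun X hX => ?_) (hrange.trans h'.symm)
      rcases subset_pair_iff_eq.1 (hfs X) with h0 | h1 | h2 | h3
      · exact absurd (image_eq_empty.1 h0) (hF X hX).ne_empty
      · exact .inr (.inl ⟨a, h1⟩)
      · exact .inr (.inl ⟨b, h2⟩)
      · exact .inr (.inr (h3 ▸ h' ▸ h))
    · exact retract a b hab hGE h' (h' ▸ h)
    · exact retract b a hab.symm (specialFamily_comm a b ▸ hGE) h' (h' ▸ h)

/-- A cardinality-preserving permutation of the special family is induced by a permutation of the
underlying set. -/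
theorem exists_perm_image_eq {m : ℕ} (hm : 2 ≤ m) (hM : Nat.card M = m + 1) (hab : a ≠ b)
    (σ : Equiv.Perm (specialFamily a b))
    (hσ : ∀ X : specialFamily a b, (σ X : Set M).ncard = (X : Set M).ncard) :
    ∃ τ : Equiv.Perm M, ∀ X : specialFamily a b, τ '' (X : Set M) = σ X := by
  classical
  have := Nat.finite_of_card_ne_zero (hM.trans_ne m.succ_ne_zero)
  have hcinj : Function.Injective fun x : M => ({x}ᶜ : Set M) := fun x y h =>
    singleton_injective (compl_injective h)
  have hc : ∀ x : M, ({x}ᶜ : Set M).ncard = m := fun x => by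
    have := ncard_add_ncard_compl {x}
    rw [ncard_singleton, hM] at this
    lia
  let A : specialFamily a b := ⟨{a}ᶜ, .inr (.inl rfl)⟩
  let B : specialFamily a b := ⟨{b}ᶜ, .inr (.inr rfl)⟩
  let D : specialFamily a b := ⟨{a, b}, .inl rfl⟩
  have hAB : A ≠ B := fun h => hab (hcinj (congrArg Subtype.val h))
  have hcase : ∀ X : specialFamily a b, X = D ∨ X = A ∨ X = B := fun ⟨X, hX⟩ => by
    rcases hX with h | h | h
    · exact .inl (Subtype.ext h)
    · exact .inr (.inl (Subtype.ext h))
    · exact .inr (.inr (Subtype.ext h))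
  have himg : ∀ (τ : Equiv.Perm M) x, τ '' {x}ᶜ = {τ x}ᶜ := fun τ x => by
    rw [image_compl_eq τ.bijective, image_singleton]
  -- For m = 2 the family consists of all complements of points, so σ is itself a permutation of M.
  -- For m > 2 the pair {a,b} is the only member of size 2, and σ can at most swap the other two.
  rcases hm.eq_or_lt with rfl | hm
  · obtain ⟨c, hcD⟩ : ∃ c, ({a, b} : Set M)ᶜ = {c} := by
      rw [← ncard_eq_one]
      have := ncard_add_ncard_compl ({a, b} : Set M)
      rw [ncard_pair hab, hM] at this
      lia
    have hD : ({a, b} : Set M) = {c}ᶜ := by rw [← hcD, compl_compl]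
    have hmem : ∀ x : M, ({x}ᶜ : Set M) ∈ specialFamily a b := by
      intro x
      by_cases hx : x ∈ ({a, b} : Set M)
      · rcases hx with rfl | rfl
        · exact A.2
        · exact B.2
      · have : x = c := by
          have : x ∈ ({a, b} : Set M)ᶜ := hx
          rwa [hcD] at this
        rw [this, ← hD]
        exact D.2
    let e : M ≃ specialFamily a b := Equiv.ofBijective (fun x => ⟨{x}ᶜ, hmem x⟩)
      ⟨fun x y h => hcinj (congrArg Subtype.val h), fun X => by
        rcases hcase X with rfl | rfl | rfl
        · exact ⟨c, Subtype.ext hD.symm⟩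
        · exact ⟨a, rfl⟩
        · exact ⟨b, rfl⟩⟩
    refine ⟨e.trans (σ.trans e.symm), fun X => ?_⟩
    obtain ⟨x, rfl⟩ := e.surjective X
    change _ '' {x}ᶜ = _
    rw [himg]
    change (e (e.symm (σ (e x))) : Set M) = _
    rw [e.apply_symm_apply]
  · have hDcard : (D : Set M).ncard = 2 := ncard_pair hab
    have hD : ∀ X : specialFamily a b, (X : Set M).ncard = 2 → X = D := fun X hX => by
      rcases hcase X with h | rfl | rfl
      · exact h
      · exact absurd ((hc a).symm.trans hX) (by lia)
      · exact absurd ((hc b).symm.trans hX) (by lia)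
    have hσD : σ D = D := hD _ ((hσ D).trans hDcard)
    have hAD : A ≠ D := fun h => by
      have h1 : (A : Set M).ncard = m := hc a
      rw [h, hDcard] at h1
      lia
    have hBD : B ≠ D := fun h => by
      have h1 : (B : Set M).ncard = m := hc b
      rw [h, hDcard] at h1
      lia
    have hσne : ∀ X, X ≠ D → σ X ≠ D := fun X hX h => hX (σ.injective (h.trans hσD.symm))
    have hσAB : σ A ≠ σ B := fun h => hAB (σ.injective h)
    rcases hcase (σ A) with hA | hA | hA
    · exact absurd hA (hσne A hAD)
    · have hB : σ B = B := by
        rcases hcase (σ B) with hB | hB | hB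
        · exact absurd hB (hσne B hBD)
        · exact absurd (hA.trans hB.symm) hσAB
        · exact hB
      refine ⟨1, fun X => ?_⟩
      rcases hcase X with rfl | rfl | rfl
      · rw [hσD]; simp
      · rw [hA]; simp
      · rw [hB]; simp
    · have hB : σ B = A := by
        rcases hcase (σ B) with hB | hB | hB
        · exact absurd hB (hσne B hBD)
        · exact hB
        · exact absurd (hA.trans hB.symm) hσAB
      refine ⟨Equiv.swap a b, fun X => ?_⟩
      rcases hcase X with rfl | rfl | rfl
      · rw [hσD]
        change _ '' {a, b} = ({a, b} : Set M)
        rw [image_pair, Equiv.swap_apply_left, Equiv.swap_apply_right, pair_comm]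
      · rw [hA]
        exact (himg _ _).trans (by rw [Equiv.swap_apply_left])
      · rw [hB]
        exact (himg _ _).trans (by rw [Equiv.swap_apply_right])

end Special

/-- An injective partial self-map of a finite type that preserves a labelling extends to a
label-preserving permutation. -/
theorem exists_perm_extend_of_injOn {α β : Type*} [Finite α] (c : α → β) (s : Set α) (f : α → α)
    (hf : InjOn f s) (hc : ∀ x ∈ s, c (f x) = c x) :
    ∃ σ : Equiv.Perm α, (∀ x, c (σ x) = c x) ∧ ∀ x ∈ s, σ x = f x := by
  classical
  have := Fintype.ofFinite α
  -- The extension is made separately inside each label class, which the partial map preserves.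
  have hfib : ∀ k : β, ∃ g : {x // c x = k} ≃ (Finset.univ.filter fun x : α => c x = k),
      ∀ i ∈ {x : {x // c x = k} | x.1 ∈ s}, (g i : α) = f i.1 := by
    intro k
    refine Set.MapsTo.exists_equiv_extend_of_card_eq (f := fun x : {x // c x = k} => f x.1)
      (Fintype.card_subtype _) (fun x hx => ?_) (fun x hx y hy h => Subtype.ext (hf hx hy h))
    simpa using (hc _ hx).trans x.2
  choose g hg using hfib
  let σ : α → α := fun x => g (c x) ⟨x, rfl⟩
  have hσc : ∀ x, c (σ x) = c x := fun x => by
    exact (Finset.mem_filter.1 (g (c x) ⟨x, rfl⟩).2).2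
  have hσg : ∀ k x (h : c x = k), σ x = g k ⟨x, h⟩ := by
    rintro _ x rfl
    rfl
  have hinj : Function.Injective σ := by
    intro x y h
    have hk : c x = c y := by rw [← hσc x, h, hσc]
    rw [hσg (c y) x hk, hσg (c y) y rfl] at h
    exact congrArg Subtype.val ((g (c y)).injective (Subtype.ext h))
  exact ⟨Equiv.ofBijective σ (Finite.injective_iff_bijective.1 hinj), hσc,
    fun x hx => hg _ ⟨x, rfl⟩ hx⟩

theorem exists_perm_specialFamily {M : Type u} [Finite M] {a b : M} {F G : Set (Set M)}
    (hG : G ⊆ specialFamily a b) {f : M → M} (hf : Function.Injective f)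
    (hFG : ∀ X ∈ F, f '' X ∈ G) :
    ∃ σ : Equiv.Perm (specialFamily a b),
      (∀ X : specialFamily a b, (σ X : Set M).ncard = (X : Set M).ncard) ∧
      ∀ X : specialFamily a b, (X : Set M) ∈ F → (σ X : Set M) ∈ G := by
  classical
  let s : Set (specialFamily a b) := {X | X.1 ∈ F}
  let φ : specialFamily a b → specialFamily a b := fun X =>
    if h : X.1 ∈ F then ⟨f '' X.1, hG (hFG _ h)⟩ else X
  have hφ : ∀ X ∈ s, (φ X : Set M) = f '' X.1 := fun X hX => by
    simp only [φ, dif_pos (show X.1 ∈ F from hX)]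
  obtain ⟨σ, h1, h2⟩ := exists_perm_extend_of_injOn
    (fun X : specialFamily a b => (X : Set M).ncard) s φ
    (fun X hX Y hY h => Subtype.ext (hf.image_injective
      (by rw [← hφ X hX, ← hφ Y hY, h])))
    (fun X hX => by rw [hφ X hX, ncard_image_of_injective _ hf])
  refine ⟨σ, h1, fun X hX => ?_⟩
  rw [h2 X hX, hφ X hX]
  exact hFG _ hX

theorem theorem3p4 {M : Type u} (m : ℕ) (hm : 2 ≤ m) (hM : Nat.card M = m + 1)
    (a b : M) (hab : a ≠ b) :
    (∀ F : Set (Set M), F ⊂ specialFamily a b →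
      ¬ IsQuasivarietyCover (Pa m) (quasivarietyOf (dualAlg (ReducedPoset F)))) ∧
    (∀ F G : Set (Set M), F ⊆ specialFamily a b → G ⊆ specialFamily a b →
      ((∃ (n : ℕ) (h : (Σ _ : Fin n, ReducedPoset F) → ReducedPoset G),
          IsPPMorphism h ∧ Function.Surjective h) ↔
        ∃ σ : Equiv.Perm (specialFamily a b),
          (∀ X : specialFamily a b, (σ X : Set M).ncard = (X : Set M).ncard) ∧
          ∀ X : specialFamily a b, (X : Set M) ∈ F → (σ X : Set M) ∈ G)) := by
  have : Finite M := Nat.finite_of_card_ne_zero (hM.trans_ne m.succ_ne_zero)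
  have : Nonempty M := ⟨a⟩
  have hcard : ∀ X ∈ specialFamily a b, 2 ≤ X.ncard ∧ X.ncard ≤ m := fun X hX => by
    rcases ncard_of_mem_specialFamily hM hab hX with ⟨-, h⟩ | h <;> lia
  have hE : ∀ X ∈ specialFamily a b, X.Nonempty := fun X hX =>
    nonempty_of_ncard_ne_zero (by have := hcard X hX; lia)
  have huniv : (univ : Set M).ncard = m + 1 := by rw [ncard_univ, hM]
  refine ⟨fun F hFE hcov => ?_, fun F G hF hG => ⟨?_, ?_⟩⟩
  · have := Fintype.ofFinite M
    have hF : ∀ X ∈ F, X.Nonempty := fun X hX => hE X (hFE.1 hX)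
    let S : Set QuasiIdentity := {q | q.HoldsIn (Upset (ReducedPoset (specialFamily a b))) ∧
      ∀ A ∈ Pa.{u} m, q.HoldsIn A.carrier}
    -- The quasivariety generated by Pa_m together with ε(P(M,E)).
    let L : Set PAlg.{u} := {A | ∀ q ∈ S, q.HoldsIn A.carrier}
    have hEL : dualAlg (ReducedPoset (specialFamily a b)) ∈ L := fun q hq => hq.1
    rcases hcov.2 L ⟨S, rfl⟩ (fun A hA q hq => hq.2 A hA) (fun A hA q hq => hA q
      ⟨hq.upset_of_covering (exists_ppMorphism_covering hab hF subset_rfl hE 1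
        (fun X hX => by simpa using hFE.1 hX)), fun B hB => hcov.1.1 hB q hq⟩) with hL | hL
    · rw [hL] at hEL
      exact ReducedPoset.sup_star_atom_ne_top hE
        (sup_star_eq_top_of_mem_Pa (by lia) hEL (by lia) (ReducedPoset.atom hE)
          fun i j hij => ReducedPoset.atom_inf_atom hE hij)
    · obtain ⟨q, hq⟩ := exists_quasiIdentity_iff_hom
        (Finset.univ.sup (fun x => PAlgebra.star (ReducedPoset.atom hF x))) ⊤
      have hqS : q ∈ S := by
        refine ⟨(hq _).2 fun g hg => ?_, fun A hA => (hq _).2 fun g hg => ?_⟩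
        · by_contra hne
          obtain ⟨s, hs, hpre⟩ := ReducedPoset.exists_preimage_of_hom hF hE hg hne
          have hmaps : ∀ X ∈ specialFamily a b, s ⁻¹' X ∈ F := by
            intro X hX
            obtain ⟨p, hp⟩ := hpre ⟨X, .inr (.inr hX)⟩
            have hn : (s ⁻¹' X).ncard = X.ncard :=
              ncard_preimage_of_injective_subset_range hs.1 (by simp [hs.2.range_eq])
            have hX' := hcard X hX
            have hpX : p.1.ncard = X.ncard := hp ▸ hn
            -- With between 2 and m elements, the preimage is neither a singleton nor M.
            exact hp ▸ p.mem_of_ncard (by lia) (fun h => by rw [h, huniv] at hpX; lia)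
          have hle : (specialFamily a b).ncard ≤ F.ncard :=
            ncard_le_ncard_of_injOn (fun X => s ⁻¹' X) hmaps
              hs.2.preimage_injective.injOn (toFinite _)
          exact absurd (ncard_lt_ncard hFE (toFinite _)) (by lia)
        · rw [hg.map_finset_sup, hg.map_top]
          simp only [hg.map_star]
          refine sup_star_eq_top_of_mem_Pa (by lia) hA (by lia) _ fun i j hij => ?_
          rw [← hg.map_inf, ReducedPoset.atom_inf_atom hF hij, hg.map_bot]
      have hFL : dualAlg (ReducedPoset F) ∈ L := hL ▸ fun q hq => hq
      exact ReducedPoset.sup_star_atom_ne_top hF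
        ((hq _).1 (hFL q hqS) id isPAlgebraHom_id)
  · rintro ⟨n, h, hh, hsurj⟩
    have hF' : ∀ X ∈ F, X.Nonempty := fun X hX => hE X (hF hX)
    have hG' : ∀ X ∈ G, X.Nonempty := fun X hX => hE X (hG hX)
    -- Only the copy that hits the least element M matters: its underlying map is onto, hence
    -- bijective.
    obtain ⟨⟨k, p⟩, hp⟩ := hsurj ⟨univ, .inl rfl⟩
    obtain ⟨f, hf⟩ := ReducedPoset.exists_image_eq_of_isPPMorphism hF' hG'
      (isPPMorphism_sigma_iff.1 hh k)
    have hfsurj : Function.Surjective f := fun y => by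
      have h1 := hf p
      rw [hp] at h1
      obtain ⟨x, -, hx⟩ := h1.subset (mem_univ y)
      exact ⟨x, hx⟩
    have hfinj : Function.Injective f := Finite.injective_iff_surjective.2 hfsurj
    refine exists_perm_specialFamily hG hfinj fun X hX => ?_
    have h1 := hf ⟨X, .inr (.inr hX)⟩
    have h2 := ncard_image_of_injective X hfinj
    have h3 := hcard X (hF hX)
    rw [← h1] at h2 ⊢
    exact ReducedPoset.mem_of_ncard _ (by lia) (fun h => by rw [h, huniv] at h2; lia)
  · rintro ⟨σ, hσ, hFG⟩
    obtain ⟨τ, hτ⟩ := exists_perm_image_eq hm hM hab σ hσ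
    exact exists_copies_surjective_of_covering (exists_ppMorphism_covering hab
      (fun X hX => hE X (hF hX)) hG (fun X hX => hE X (hG hX)) τ
      fun X hX => hτ ⟨X, hF hX⟩ ▸ hFG ⟨X, hF hX⟩ hX)
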